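/- Let $s(n,j)$, for integers $n\ge j\ge 0$, denote the (signed) Stirling numbers of the first kind, generated by $$\frac{[\ln(1+x)]^j}{j!}=\sum_{n=j}^\infty s(n,j)\frac{x^n}{n!},\qquad |x|<1,$$ and for integers $k\ge 1$ and $m\ge 2$ put $$Q(k,m)=\sum_{\ell=0}^{m}\binom{k+\ell-1}{k-1}\,s(k+m-1,\,k+\ell-1)\left(\frac{k+m-2}{2}\right)^{\ell}.$$ Then for every integer $k\ge 1$ the following series converges and $$\left(\frac{\pi^2}{8}\right)^k=1+(2k)!\sum_{m=1}^{\infty}(-1)^m 2^m\,\frac{Q(2k,2m)}{(2k+2m)!}.$$ In particular, also with a convergent series, $$\frac{\pi^2}{8}=\sum_{m=1}^{\infty}\frac{2^m}{m^2}\,\frac{1}{\binom{2m}{m}}.$$ -/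

import Mathlib

/-- The signed Stirling number of the first kind `s(n, k)`, that is `(-1) ^ (n - k)` times the
unsigned one (the exponent `n + k` has the parity of `n - k`); equivalently
`log (1 + x) ^ k / k! = ∑_{n ≥ k} s(n, k) x ^ n / n!` for `|x| < 1`. -/
def signedStirlingFirst (n k : ℕ) : ℤ :=
  (-1) ^ (n + k) * (Nat.stirlingFirst n k : ℤ)

/-- `Q(k, m) = ∑_{ℓ = 0}^{m} C(k + ℓ - 1, k - 1) s(k + m - 1, k + ℓ - 1) ((k + m - 2) / 2) ^ ℓ`,
used for `k ≥ 1` and `m ≥ 2`, where no subtraction of natural numbers truncates. -/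
noncomputable def stirlingQ (k m : ℕ) : ℝ :=
  ∑ l ∈ Finset.range (m + 1),
    (Nat.choose (k + l - 1) (k - 1) : ℝ) * (signedStirlingFirst (k + m - 1) (k + l - 1) : ℝ) *
      (((k : ℝ) + (m : ℝ) - 2) / 2) ^ l

/-! `stirlingQ (2 * k) (2 * m)` is a Taylor coefficient of a falling factorial of odd degree at the
midpoint of its roots. There the polynomial becomes `X * ∏ (X ^ 2 - j ^ 2)`, so the value is `(-1) ^
m` times a central factorial coefficient c(k, k + m) (`stirlingQ_two_mul`). Both series are then the
case θ = π/4 of (2θ)^(2k)/(2k)! = ∑ c(k, n) (2 sin θ)^(2n)/(2n)!, where (2 sin θ)^2 = 2. The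
expansion is proved without power series. Differentiating a remainder twice lowers k by one, up to
an explicit boundary term, so induction on k bounds it below by 0 (`sinRemainder_nonneg`) and above
by a null sequence (`exists_tendsto_sinRemainder_le`). -/

/-! ### Stirling sums as Taylor coefficients of falling factorials -/

open Polynomial in
/-- The coefficients of the falling factorial are the signed Stirling numbers. -/
theorem coeff_descPochhammer_eq_signedStirlingFirst (n i : ℕ) :
    (descPochhammer ℝ n).coeff i = (signedStirlingFirst n i : ℝ) := by
  induction n generalizing i with
  | zero =>
    cases i with
    | zero => simp [signedStirlingFirst]
    | succ i => simp [signedStirlingFirst, coeff_one]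
  | succ n ih =>
    rw [descPochhammer_succ_right, mul_sub, coeff_sub, ← C_eq_natCast, coeff_mul_C]
    cases i with
    | zero =>
      rw [coeff_mul_X_zero, ih]
      cases n with
      | zero => simp [signedStirlingFirst]
      | succ n => simp [signedStirlingFirst]
    | succ i =>
      rw [coeff_mul_X, ih, ih]
      simp only [signedStirlingFirst, Nat.stirlingFirst_succ_succ]
      push_cast
      ring

open Polynomial in
theorem coeff_taylor_descPochhammer (a b : ℕ) (x : ℝ) :
    (taylor x (descPochhammer ℝ (a + b))).coeff a =
      ∑ l ∈ Finset.range (b + 1), (Nat.choose (a + l) a : ℝ) *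
        (signedStirlingFirst (a + b) (a + l) : ℝ) * x ^ l := by
  rw [taylor_coeff, hasseDeriv_apply, sum_over_range' _ (by simp) (a + (b + 1))
    (by rw [descPochhammer_natDegree]; omega), eval_finsetSum, Finset.sum_range_add,
    Finset.sum_eq_zero, zero_add]
  · refine Finset.sum_congr rfl fun l _ => ?_
    rw [eval_monomial, coeff_descPochhammer_eq_signedStirlingFirst, Nat.add_sub_cancel_left]
  · intro i hi
    rw [Nat.choose_eq_zero_of_lt (Finset.mem_range.mp hi)]
    simp

-- The roots 0, ..., 2n are symmetric about n. The induction splits off the two extreme roots, which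
-- leaves a translate of the previous polynomial.
open Polynomial in
theorem taylor_descPochhammer_odd (n : ℕ) :
    taylor (n : ℝ) (descPochhammer ℝ (2 * n + 1)) =
      X * ∏ j ∈ Finset.range n, (X ^ 2 - C (((j : ℝ) + 1) ^ 2)) := by
  induction n with
  | zero => simp
  | succ n ih =>
    have h : descPochhammer ℝ (2 * (n + 1) + 1) =
        X * taylor (-1) (descPochhammer ℝ (2 * n + 1)) * (X - C (2 * (n : ℝ) + 2)) := by
      rw [show 2 * (n + 1) + 1 = (2 * n + 1 + 1) + 1 by ring, descPochhammer_succ_right,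
        descPochhammer_succ_left, taylor_apply]
      simp only [map_neg, map_one, map_add, map_mul, map_natCast, map_ofNat,
        Nat.cast_add, Nat.cast_mul, Nat.cast_ofNat, sub_eq_add_neg]
    rw [h, taylor_mul, taylor_mul, taylor_taylor, Finset.prod_range_succ, ← mul_assoc, ← ih]
    have e : ((n + 1 : ℕ) : ℝ) + -1 = n := by push_cast; ring
    simp only [e, map_sub, taylor_X, taylor_C]
    simp only [map_add, map_mul, map_pow, map_natCast, map_one, map_ofNat, Nat.cast_add,
      Nat.cast_one]
    ring

/-! ### Central factorial coefficients -/

/-- The central factorial coefficients: `centralFactorialCoeff k n` is the coefficient of `X ^ k`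
in `∏ j < n, (X + j ^ 2)`. -/
def centralFactorialCoeff : ℕ → ℕ → ℕ
  | 0, 0 => 1
  | _ + 1, 0 => 0
  | 0, _ + 1 => 0
  | k + 1, n + 1 => centralFactorialCoeff k n + n ^ 2 * centralFactorialCoeff (k + 1) n

theorem centralFactorialCoeff_succ_succ (k n : ℕ) :
    centralFactorialCoeff (k + 1) (n + 1) =
      centralFactorialCoeff k n + n ^ 2 * centralFactorialCoeff (k + 1) n := by
  rw [centralFactorialCoeff]

theorem centralFactorialCoeff_zero_succ (n : ℕ) : centralFactorialCoeff 0 (n + 1) = 0 := by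
  rw [centralFactorialCoeff]

theorem centralFactorialCoeff_succ_zero (k : ℕ) : centralFactorialCoeff (k + 1) 0 = 0 := by
  rw [centralFactorialCoeff]

theorem centralFactorialCoeff_eq_zero_of_lt {k n : ℕ} (h : n < k) :
    centralFactorialCoeff k n = 0 := by
  induction n generalizing k with
  | zero => obtain ⟨k, rfl⟩ := Nat.exists_eq_succ_of_ne_zero h.ne'; rw [centralFactorialCoeff]
  | succ n ih =>
    obtain ⟨k, rfl⟩ := Nat.exists_eq_succ_of_ne_zero (Nat.ne_zero_of_lt h)
    rw [Nat.succ_eq_add_one, centralFactorialCoeff_succ_succ, ih (by omega), ih (by omega)]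
    simp

theorem centralFactorialCoeff_self (k : ℕ) : centralFactorialCoeff k k = 1 := by
  induction k with
  | zero => rw [centralFactorialCoeff]
  | succ k ih =>
    rw [centralFactorialCoeff_succ_succ, ih, centralFactorialCoeff_eq_zero_of_lt k.lt_succ_self]
    simp

theorem centralFactorialCoeff_one_succ (n : ℕ) :
    centralFactorialCoeff 1 (n + 1) = (Nat.factorial n) ^ 2 := by
  induction n with
  | zero => exact centralFactorialCoeff_self 1
  | succ n ih =>
    rw [centralFactorialCoeff_succ_succ, zero_add, ih, centralFactorialCoeff_zero_succ,
      Nat.factorial_succ]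
    ring

open Polynomial in
theorem coeff_prod_sq_sub_sq (n k : ℕ) :
    (∏ j ∈ Finset.range n, (X ^ 2 - C (((j : ℝ) + 1) ^ 2))).coeff (2 * k) =
      (-1) ^ (n + k) * (centralFactorialCoeff (k + 1) (n + 1) : ℝ) := by
  induction n generalizing k with
  | zero =>
    cases k with
    | zero => simp [centralFactorialCoeff]
    | succ k => simp [centralFactorialCoeff, coeff_one]
  | succ n ih =>
    rw [Finset.prod_range_succ, mul_sub, coeff_sub, coeff_mul_C, ih,
      centralFactorialCoeff_succ_succ k (n + 1)]
    cases k with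
    | zero =>
      rw [coeff_mul_X_pow', centralFactorialCoeff_zero_succ]
      simp
      ring
    | succ k =>
      rw [show 2 * (k + 1) = 2 * k + 2 by ring, coeff_mul_X_pow, ih]
      push_cast
      ring

/-- The evaluation point in `stirlingQ` is here k + m, the midpoint of the roots of the falling
factorial of degree 2(k + m) + 1. -/
theorem stirlingQ_two_mul (k m : ℕ) :
    stirlingQ (2 * (k + 1)) (2 * m) =
      (-1) ^ m * (centralFactorialCoeff (k + 1) (k + 1 + m) : ℝ) := by
  have h := coeff_taylor_descPochhammer (2 * k + 1) (2 * m) ((k + m : ℕ) : ℝ)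
  rw [show 2 * k + 1 + 2 * m = 2 * (k + m) + 1 by ring, taylor_descPochhammer_odd,
    Polynomial.coeff_X_mul, coeff_prod_sq_sub_sq] at h
  rw [show k + 1 + m = k + m + 1 by ring,
    show ((-1 : ℝ)) ^ m = (-1) ^ (k + m + k) by
      rw [show k + m + k = m + 2 * k by ring, pow_add, pow_mul]; simp, h, stirlingQ]
  refine Finset.sum_congr rfl fun l _ => ?_
  rw [show 2 * (k + 1) + l - 1 = 2 * k + 1 + l by omega,
    show 2 * (k + 1) - 1 = 2 * k + 1 by omega,
    show 2 * (k + 1) + 2 * m - 1 = 2 * (k + m) + 1 by omega]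
  congr 2
  push_cast
  ring

/-! ### Powers of the sine and remainders -/

/-- The function `θ ↦ (2 sin θ) ^ (2 n) / (2 n)!`. -/
noncomputable def sinPow (n : ℕ) (θ : ℝ) : ℝ :=
  (2 * Real.sin θ) ^ (2 * n) / (Nat.factorial (2 * n) : ℝ)

/-- The derivative of `sinPow (n + 1)`. -/
noncomputable def sinPowDeriv (n : ℕ) (θ : ℝ) : ℝ :=
  2 * Real.cos θ * (2 * Real.sin θ) ^ (2 * n + 1) / (Nat.factorial (2 * n + 1) : ℝ)

theorem hasDerivAt_sinPow (n : ℕ) (θ : ℝ) :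
    HasDerivAt (sinPow (n + 1)) (sinPowDeriv n θ) θ := by
  have h := ((((Real.hasDerivAt_sin θ).const_mul 2).pow (2 * (n + 1))).div_const
    (Nat.factorial (2 * (n + 1)) : ℝ))
  refine h.congr_deriv ?_
  rw [sinPowDeriv, show 2 * (n + 1) = 2 * n + 1 + 1 by ring, Nat.factorial_succ,
    Nat.add_sub_cancel]
  have : (Nat.factorial (2 * n + 1) : ℝ) ≠ 0 := by positivity
  push_cast
  field_simp

theorem hasDerivAt_sinPowDeriv (n : ℕ) (θ : ℝ) :
    HasDerivAt (sinPowDeriv n)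
      (4 * sinPow n θ - 4 * ((n : ℝ) + 1) ^ 2 * sinPow (n + 1) θ) θ := by
  have h := ((((Real.hasDerivAt_cos θ).const_mul 2).mul
    (((Real.hasDerivAt_sin θ).const_mul 2).pow (2 * n + 1))).div_const
    (Nat.factorial (2 * n + 1) : ℝ))
  refine h.congr_deriv ?_
  rw [sinPow, sinPow, show 2 * (n + 1) = 2 * n + 1 + 1 by ring, Nat.factorial_succ (2 * n + 1),
    Nat.factorial_succ (2 * n), Nat.add_sub_cancel]
  have : (Nat.factorial (2 * n) : ℝ) ≠ 0 := by positivity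
  simp only [Pi.pow_apply]
  push_cast
  field_simp
  linear_combination (8 * (2 * (n : ℝ) + 1) * ((n : ℝ) + 1) * (2 * Real.sin θ) ^ (2 * n)) *
    Real.sin_sq_add_cos_sq θ

theorem sinPow_nonneg (n : ℕ) (θ : ℝ) : 0 ≤ sinPow n θ := by
  rw [sinPow, pow_mul]; positivity

/-- The difference between `(2 θ) ^ (2 k) / (2 k)!` and a partial sum of its expansion in powers
of `2 sin θ`. -/
noncomputable def sinRemainder (k N : ℕ) (θ : ℝ) : ℝ :=
  (2 * θ) ^ (2 * k) / (Nat.factorial (2 * k) : ℝ) -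
    ∑ n ∈ Finset.range N, (centralFactorialCoeff k n : ℝ) * sinPow n θ

/-- The derivative of `sinRemainder (k + 1) (N + 1)`. -/
noncomputable def sinRemainderDeriv (k N : ℕ) (θ : ℝ) : ℝ :=
  2 * (2 * θ) ^ (2 * k + 1) / (Nat.factorial (2 * k + 1) : ℝ) -
    ∑ n ∈ Finset.range N, (centralFactorialCoeff (k + 1) (n + 1) : ℝ) * sinPowDeriv n θ

theorem hasDerivAt_sinRemainder (k N : ℕ) (θ : ℝ) :
    HasDerivAt (sinRemainder (k + 1) (N + 1)) (sinRemainderDeriv k N θ) θ := by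
  have e : sinRemainder (k + 1) (N + 1) = fun θ =>
      (2 * θ) ^ (2 * (k + 1)) / (Nat.factorial (2 * (k + 1)) : ℝ) -
        ∑ n ∈ Finset.range N, (centralFactorialCoeff (k + 1) (n + 1) : ℝ) * sinPow (n + 1) θ := by
    funext θ
    rw [sinRemainder, Finset.sum_range_succ', centralFactorialCoeff_succ_zero]
    simp
  rw [e]
  have h1 := (((hasDerivAt_id θ).const_mul 2).pow (2 * (k + 1))).div_const
    (Nat.factorial (2 * (k + 1)) : ℝ)
  have h2 := HasDerivAt.fun_sum (u := Finset.range N) fun n _ =>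
    (hasDerivAt_sinPow n θ).const_mul (centralFactorialCoeff (k + 1) (n + 1) : ℝ)
  refine (h1.sub h2).congr_deriv ?_
  rw [sinRemainderDeriv, show 2 * (k + 1) = 2 * k + 1 + 1 by ring, Nat.factorial_succ,
    Nat.add_sub_cancel]
  have : (Nat.factorial (2 * k + 1) : ℝ) ≠ 0 := by positivity
  congr 1
  push_cast
  simp only [id]
  field_simp

/-- Summation by parts: the recurrence of the coefficients cancels everything but one boundary term.
-/
theorem sum_centralFactorialCoeff_mul (k N : ℕ) (θ : ℝ) :
    ∑ n ∈ Finset.range N, (centralFactorialCoeff (k + 1) (n + 1) : ℝ) *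
        (4 * sinPow n θ - 4 * ((n : ℝ) + 1) ^ 2 * sinPow (n + 1) θ) =
      4 * ∑ n ∈ Finset.range N, (centralFactorialCoeff k n : ℝ) * sinPow n θ -
        4 * (N : ℝ) ^ 2 * ((centralFactorialCoeff (k + 1) N : ℝ) * sinPow N θ) := by
  induction N with
  | zero => simp
  | succ N ih =>
    rw [Finset.sum_range_succ, ih, Finset.sum_range_succ, centralFactorialCoeff_succ_succ]
    push_cast
    ring

theorem hasDerivAt_sinRemainderDeriv (k N : ℕ) (θ : ℝ) :
    HasDerivAt (sinRemainderDeriv k N)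
      (4 * sinRemainder k N θ +
        4 * (N : ℝ) ^ 2 * ((centralFactorialCoeff (k + 1) N : ℝ) * sinPow N θ)) θ := by
  have h1 := ((((hasDerivAt_id θ).const_mul 2).pow (2 * k + 1)).const_mul 2).div_const
    (Nat.factorial (2 * k + 1) : ℝ)
  have h2 := HasDerivAt.fun_sum (u := Finset.range N) fun n _ =>
    (hasDerivAt_sinPowDeriv n θ).const_mul (centralFactorialCoeff (k + 1) (n + 1) : ℝ)
  refine (h1.sub h2).congr_deriv ?_
  rw [sum_centralFactorialCoeff_mul, sinRemainder, Nat.factorial_succ, Nat.add_sub_cancel]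
  have : (Nat.factorial (2 * k) : ℝ) ≠ 0 := by positivity
  push_cast
  simp only [id]
  field_simp
  ring

/-! ### Bounds for the remainder -/

/-- A function with nonnegative second derivative on `[0, b]` which vanishes to first order at `0`
is nonnegative. -/
theorem nonneg_of_second_deriv_nonneg {f f' f'' : ℝ → ℝ} {b : ℝ}
    (hf : ∀ x, HasDerivAt f (f' x) x) (hf' : ∀ x, HasDerivAt f' (f'' x) x)
    (h0 : f 0 = 0) (h0' : f' 0 = 0) (h : ∀ x ∈ Set.Icc 0 b, 0 ≤ f'' x)
    {x : ℝ} (hx : x ∈ Set.Icc 0 b) : 0 ≤ f x := by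
  have key : ∀ {g g' : ℝ → ℝ}, (∀ x, HasDerivAt g (g' x) x) → g 0 = 0 →
      (∀ x ∈ Set.Icc 0 b, 0 ≤ g' x) → ∀ x ∈ Set.Icc 0 b, 0 ≤ g x := by
    intro g g' hg hg0 hg' x hx
    have hm : MonotoneOn g (Set.Icc 0 b) := by
      refine monotoneOn_of_deriv_nonneg (convex_Icc 0 b)
        (fun y _ => (hg y).continuousAt.continuousWithinAt)
        (fun y _ => (hg y).differentiableAt.differentiableWithinAt) fun y hy => ?_
      rw [(hg y).deriv]
      exact hg' y (interior_subset hy)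
    have := hm (Set.left_mem_Icc.mpr (hx.1.trans hx.2)) hx hx.1
    rwa [hg0] at this
  exact key hf h0 (key hf' h0' h) x hx

theorem sinRemainder_succ_succ_zero (k N : ℕ) : sinRemainder (k + 1) (N + 1) 0 = 0 := by
  rw [sinRemainder, Finset.sum_range_succ', centralFactorialCoeff_succ_zero]
  simp [sinPow]

theorem sinRemainderDeriv_zero (k N : ℕ) : sinRemainderDeriv k N 0 = 0 := by
  simp [sinRemainderDeriv, sinPowDeriv]

theorem sinRemainder_zero_succ (N : ℕ) (θ : ℝ) : sinRemainder 0 (N + 1) θ = 0 := by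
  rw [sinRemainder, Finset.sum_range_succ']
  simp [centralFactorialCoeff, sinPow]

theorem sinRemainder_nonneg (k N : ℕ) (b : ℝ) {θ : ℝ} (hθ : θ ∈ Set.Icc 0 b) :
    0 ≤ sinRemainder k N θ := by
  induction k generalizing N θ with
  | zero =>
    cases N with
    | zero => simp [sinRemainder]
    | succ N => rw [sinRemainder_zero_succ]
  | succ k ih =>
    cases N with
    | zero =>
      have := hθ.1
      rw [sinRemainder, Finset.sum_range_zero, sub_zero]
      positivity
    | succ N =>
      refine nonneg_of_second_deriv_nonneg (hasDerivAt_sinRemainder k N)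
        (hasDerivAt_sinRemainderDeriv k N) (sinRemainder_succ_succ_zero k N)
        (sinRemainderDeriv_zero k N) (fun x hx => ?_) hθ
      have h1 := ih N hx
      have h2 := sinPow_nonneg N x
      positivity

/-- Nonnegativity of the remainder at π/2 bounds each single term there; passing to [0, π/4] gains
(sin θ)^(2n) ≤ 2^(-n). This decay beats the factor N^2 in the boundary term. -/
theorem centralFactorialCoeff_mul_sinPow_le (k n : ℕ) {θ : ℝ}
    (hθ : θ ∈ Set.Icc 0 (Real.pi / 4)) :
    (centralFactorialCoeff k n : ℝ) * sinPow n θ ≤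
      Real.pi ^ (2 * k) / (Nat.factorial (2 * k) : ℝ) * (1 / 2) ^ n := by
  have hpi := Real.pi_pos
  have hs : Real.sin θ ^ 2 ≤ 1 / 2 := by
    have h1 : Real.sin θ ≤ Real.sin (Real.pi / 4) :=
      Real.sin_le_sin_of_le_of_le_pi_div_two (by linarith [hθ.1]) (by linarith) hθ.2
    have h2 : 0 ≤ Real.sin θ := Real.sin_nonneg_of_nonneg_of_le_pi hθ.1 (by linarith [hθ.2])
    calc Real.sin θ ^ 2 ≤ Real.sin (Real.pi / 4) ^ 2 := by gcongr
      _ = 1 / 2 := by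
        rw [Real.sin_pi_div_four, div_pow, Real.sq_sqrt (by norm_num)]; norm_num
  have hle : (centralFactorialCoeff k n : ℝ) * sinPow n (Real.pi / 2) ≤
      Real.pi ^ (2 * k) / (Nat.factorial (2 * k) : ℝ) := by
    have h := sinRemainder_nonneg k (n + 1) (Real.pi / 2)
      (Set.right_mem_Icc.mpr (by positivity))
    rw [sinRemainder, Finset.sum_range_succ, mul_div_cancel₀ _ (two_ne_zero' ℝ)] at h
    have h' : 0 ≤ ∑ i ∈ Finset.range n,
        (centralFactorialCoeff k i : ℝ) * sinPow i (Real.pi / 2) :=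
      Finset.sum_nonneg fun i _ => mul_nonneg (Nat.cast_nonneg _) (sinPow_nonneg _ _)
    linarith
  have hg : sinPow n θ ≤ sinPow n (Real.pi / 2) * (1 / 2) ^ n := by
    rw [sinPow, sinPow, Real.sin_pi_div_two, mul_pow, pow_mul (Real.sin θ), mul_one,
      div_mul_eq_mul_div]
    gcongr
  calc (centralFactorialCoeff k n : ℝ) * sinPow n θ
      ≤ centralFactorialCoeff k n * (sinPow n (Real.pi / 2) * (1 / 2) ^ n) := by gcongr
    _ = centralFactorialCoeff k n * sinPow n (Real.pi / 2) * (1 / 2) ^ n := by ring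
    _ ≤ _ := by gcongr

theorem exists_tendsto_sinRemainder_le (k : ℕ) :
    ∃ u : ℕ → ℝ, Filter.Tendsto u Filter.atTop (nhds 0) ∧
      ∀ N, ∀ θ ∈ Set.Icc 0 (Real.pi / 4), sinRemainder k (N + k + 1) θ ≤ u N := by
  induction k with
  | zero => exact ⟨0, tendsto_const_nhds, fun N θ _ => (sinRemainder_zero_succ N θ).le⟩
  | succ k ih =>
    obtain ⟨u, hu, hle⟩ := ih
    set A : ℝ := Real.pi ^ (2 * (k + 1)) / (Nat.factorial (2 * (k + 1)) : ℝ)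
    let v : ℕ → ℝ := fun N => (N : ℝ) ^ 2 * (1 / 2) ^ N
    have hv : Filter.Tendsto v Filter.atTop (nhds 0) :=
      tendsto_pow_const_mul_const_pow_of_lt_one 2 (by norm_num) (by norm_num)
    -- Half of the bound 4 u + 4 A v for the second derivative, so that w θ^2 is a comparison
    -- function with second derivative 2 w.
    refine ⟨fun N => 2 * u N + 2 * A * v (N + (k + 1)), ?_, fun N θ hθ => ?_⟩
    · have := (hu.const_mul 2).add
        (((Filter.tendsto_add_atTop_iff_nat (k + 1)).mpr hv).const_mul (2 * A))
      simpa using this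
    · set M := N + k + 1
      set w : ℝ := 2 * u N + 2 * A * v M
      have hsecond : ∀ x ∈ Set.Icc 0 (Real.pi / 4), 4 * sinRemainder k M x +
          4 * (M : ℝ) ^ 2 * ((centralFactorialCoeff (k + 1) M : ℝ) * sinPow M x) ≤ 2 * w := by
        intro x hx
        have h1 := hle N x hx
        have h2 : (M : ℝ) ^ 2 * ((centralFactorialCoeff (k + 1) M : ℝ) * sinPow M x) ≤
            (M : ℝ) ^ 2 * (A * (1 / 2) ^ M) := by
          exact mul_le_mul_of_nonneg_left (centralFactorialCoeff_mul_sinPow_le (k + 1) M hx)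
            (by positivity)
        simp only [w, v]
        linarith
      have h0 : (0 : ℝ) ∈ Set.Icc 0 (Real.pi / 4) := ⟨le_rfl, by positivity⟩
      have hw : 0 ≤ w := by
        have h1 := hsecond 0 h0
        have h2 := sinRemainder_nonneg k M _ h0
        have h3 := sinPow_nonneg M 0
        have : 0 ≤ 4 * (M : ℝ) ^ 2 * ((centralFactorialCoeff (k + 1) M : ℝ) * sinPow M 0) := by
          positivity
        linarith
      have hcmp : 0 ≤ w * θ ^ 2 - sinRemainder (k + 1) (M + 1) θ := by
        refine nonneg_of_second_deriv_nonneg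
          (f := fun x => w * x ^ 2 - sinRemainder (k + 1) (M + 1) x)
          (f' := fun x => w * (2 * x) - sinRemainderDeriv k M x)
          (fun x => HasDerivAt.sub (by simpa using (hasDerivAt_pow 2 x).const_mul w)
            (hasDerivAt_sinRemainder k M x))
          (fun x => HasDerivAt.sub (((hasDerivAt_id x).const_mul 2).const_mul w)
            (hasDerivAt_sinRemainderDeriv k M x))
          (by simp [sinRemainder_succ_succ_zero]) (by simp [sinRemainderDeriv_zero])
          (fun x hx => ?_) hθ
        have := hsecond x hx
        linarith
      have hθ1 : θ ^ 2 ≤ 1 := by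
        have := hθ.1
        have := hθ.2
        have := Real.pi_le_four
        nlinarith
      have hfin : w * θ ^ 2 ≤ w := mul_le_of_le_one_right hw hθ1
      exact (sub_nonneg.mp hcmp).trans hfin

/-! ### Evaluation at π/4 -/

theorem sinPow_pi_div_four (n : ℕ) :
    sinPow n (Real.pi / 4) = 2 ^ n / (Nat.factorial (2 * n) : ℝ) := by
  rw [sinPow, Real.sin_pi_div_four, mul_div_cancel₀ _ (two_ne_zero' ℝ), pow_mul,
    Real.sq_sqrt (by norm_num)]

/-- The expansion of `θ ^ (2 k)` in powers of `sin θ` at `θ = π / 4`. -/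
theorem hasSum_centralFactorialCoeff (k : ℕ) :
    HasSum (fun n : ℕ => (centralFactorialCoeff k n : ℝ) * (2 ^ n / (Nat.factorial (2 * n) : ℝ)))
      ((Real.pi / 2) ^ (2 * k) / (Nat.factorial (2 * k) : ℝ)) := by
  rw [hasSum_iff_tendsto_nat_of_nonneg (fun n => by positivity)]
  obtain ⟨u, hu, hle⟩ := exists_tendsto_sinRemainder_le k
  have hmem : Real.pi / 4 ∈ Set.Icc 0 (Real.pi / 4) := Set.right_mem_Icc.mpr (by positivity)
  have hlim : Filter.Tendsto (fun N => sinRemainder k (N + (k + 1)) (Real.pi / 4))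
      Filter.atTop (nhds 0) :=
    squeeze_zero (fun N => sinRemainder_nonneg k _ _ hmem) (fun N => hle N _ hmem) hu
  rw [Filter.tendsto_add_atTop_iff_nat (f := fun N => sinRemainder k N (Real.pi / 4))] at hlim
  have := hlim.const_sub ((Real.pi / 2) ^ (2 * k) / (Nat.factorial (2 * k) : ℝ))
  rw [sub_zero] at this
  refine this.congr fun N => ?_
  rw [sinRemainder, show 2 * (Real.pi / 4) = Real.pi / 2 by ring, sub_sub_cancel]
  simp only [sinPow_pi_div_four]

theorem hasSum_pnat_iff_succ {f : ℕ → ℝ} {a : ℝ} :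
    HasSum (fun m : ℕ+ => f m) a ↔ HasSum (fun n : ℕ => f (n + 1)) a := by
  rw [← Equiv.pnatEquivNat.symm.hasSum_iff]
  rfl

theorem hasSum_stirlingQ (k : ℕ) :
    HasSum (fun m : ℕ+ => (-1 : ℝ) ^ (m : ℕ) * 2 ^ (m : ℕ) *
        (stirlingQ (2 * (k + 1)) (2 * (m : ℕ)) /
          (Nat.factorial (2 * (k + 1) + 2 * (m : ℕ)) : ℝ)))
      (((Real.pi ^ 2 / 8) ^ (k + 1) - 1) / (Nat.factorial (2 * (k + 1)) : ℝ)) := by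
  -- The terms with n ≤ k vanish, and n = k + 1 gives the isolated 1 of the formula.
  have h := (hasSum_nat_add_iff' (k + 1 + 1)).mpr (hasSum_centralFactorialCoeff (k + 1))
  rw [Finset.sum_range_succ, Finset.sum_eq_zero fun i hi => by
    rw [centralFactorialCoeff_eq_zero_of_lt (Finset.mem_range.mp hi)]; simp,
    centralFactorialCoeff_self] at h
  have e : ((Real.pi / 2) ^ (2 * (k + 1)) / (Nat.factorial (2 * (k + 1)) : ℝ) -
      (0 + ((1 : ℕ) : ℝ) * (2 ^ (k + 1) / (Nat.factorial (2 * (k + 1)) : ℝ)))) / 2 ^ (k + 1) =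
      ((Real.pi ^ 2 / 8) ^ (k + 1) - 1) / (Nat.factorial (2 * (k + 1)) : ℝ) := by
    have e : (Real.pi / 2) ^ (2 * (k + 1)) = (Real.pi ^ 2 / 8) ^ (k + 1) * 2 ^ (k + 1) := by
      rw [pow_mul, ← mul_pow]; congr 1; ring
    rw [e]
    field_simp
    ring
  have h2 := h.div_const (2 ^ (k + 1))
  rw [e] at h2
  refine (hasSum_pnat_iff_succ (f := fun m => (-1 : ℝ) ^ m * 2 ^ m *
    (stirlingQ (2 * (k + 1)) (2 * m) / (Nat.factorial (2 * (k + 1) + 2 * m) : ℝ)))).mpr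
    ((congrArg (HasSum · _) (funext fun m => ?_)).mpr h2)
  rw [stirlingQ_two_mul, show m + (k + 1 + 1) = k + 1 + (m + 1) by ring,
    show 2 * (k + 1) + 2 * (m + 1) = 2 * (k + 1 + (m + 1)) by ring]
  have hs : (-1 : ℝ) ^ (m + 1) * (-1) ^ (m + 1) = 1 := by
    rw [← mul_pow]; simp
  rw [pow_add (2 : ℝ) (k + 1) (m + 1)]
  field_simp
  linear_combination (centralFactorialCoeff (k + 1) (k + 1 + (m + 1)) : ℝ) * hs

theorem hasSum_pi_sq_div_eight :
    HasSum (fun m : ℕ+ => (2 : ℝ) ^ (m : ℕ) / ((m : ℕ) : ℝ) ^ 2 *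
      (1 / (Nat.choose (2 * (m : ℕ)) (m : ℕ) : ℝ))) (Real.pi ^ 2 / 8) := by
  have h := (hasSum_nat_add_iff' 1).mpr (hasSum_centralFactorialCoeff 1)
  have e : (Real.pi / 2) ^ (2 * 1) / (Nat.factorial (2 * 1) : ℝ) -
      ∑ i ∈ Finset.range 1, (centralFactorialCoeff 1 i : ℝ) *
        (2 ^ i / (Nat.factorial (2 * i) : ℝ)) = Real.pi ^ 2 / 8 := by
    simp [centralFactorialCoeff_succ_zero]
    ring
  rw [e] at h
  refine (hasSum_pnat_iff_succ (f := fun m => (2 : ℝ) ^ m / (m : ℝ) ^ 2 *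
      (1 / (Nat.choose (2 * m) m : ℝ)))).mpr
    ((congrArg (HasSum · _) (funext fun n => ?_)).mpr h)
  rw [centralFactorialCoeff_one_succ, Nat.cast_choose ℝ (by omega : n + 1 ≤ 2 * (n + 1)),
    show 2 * (n + 1) - (n + 1) = n + 1 by omega, Nat.factorial_succ n]
  push_cast
  field_simp

theorem corollary4p2 :
    (∀ k : ℕ, 1 ≤ k →
      Summable (fun m : ℕ+ => (-1 : ℝ) ^ (m : ℕ) * 2 ^ (m : ℕ) *
        (stirlingQ (2 * k) (2 * (m : ℕ)) / (Nat.factorial (2 * k + 2 * (m : ℕ)) : ℝ))) ∧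
      (Real.pi ^ 2 / 8) ^ k =
        1 + (Nat.factorial (2 * k) : ℝ) *
          ∑' m : ℕ+, (-1 : ℝ) ^ (m : ℕ) * 2 ^ (m : ℕ) *
            (stirlingQ (2 * k) (2 * (m : ℕ)) / (Nat.factorial (2 * k + 2 * (m : ℕ)) : ℝ))) ∧
    Summable (fun m : ℕ+ => (2 : ℝ) ^ (m : ℕ) / ((m : ℕ) : ℝ) ^ 2 *
      (1 / (Nat.choose (2 * (m : ℕ)) (m : ℕ) : ℝ))) ∧
    Real.pi ^ 2 / 8 =
      ∑' m : ℕ+, (2 : ℝ) ^ (m : ℕ) / ((m : ℕ) : ℝ) ^ 2 *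
        (1 / (Nat.choose (2 * (m : ℕ)) (m : ℕ) : ℝ)) := by
  refine ⟨fun k hk => ?_, hasSum_pi_sq_div_eight.summable, hasSum_pi_sq_div_eight.tsum_eq.symm⟩
  obtain ⟨k, rfl⟩ := Nat.exists_eq_succ_of_ne_zero (Nat.one_le_iff_ne_zero.mp hk)
  have h := hasSum_stirlingQ k
  refine ⟨h.summable, ?_⟩
  rw [h.tsum_eq, mul_div_cancel₀ _ (by positivity)]
  simp
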